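/- For finite graphs $F$ and $G$ with $|V(F)|\le |V(G)|$, let $P(F,G)$ be the number of $|V(F)|$-element subsets of $V(G)$ that induce a subgraph of $G$ isomorphic to $F$, and let $p(F,G)=P(F,G)/\binom{|V(G)|}{|V(F)|}$. For integers $k\ge 2$ and $n\ge |V(F)|$, let $i_k(F,n)$ be the maximum of $p(F,G)$ over all $K_k$-free graphs $G$ with $n$ vertices, and let $i_k(F)=\lim_{n\to\infty} i_k(F,n)$ (this limit exists). Call $F$ inducibility diverse if for every integer $k\ge 2$ there is an integer $m>k$ such that $i_k(F)<i_m(F)$. For integers $2\le r\le s$, let $T(s,r)$ be the Turán graph, that is, the complete $r$-partite graph with $s$ vertices whose (non-empty) parts have sizes that differ pairwise by at most one. Then, for all integers $2\le r\le s$, the Turán graph $T(s,r)$ is inducibility diverse if and only if it is a complete graph. -/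

import Mathlib

namespace Inducibility

open Filter Topology

open scoped Classical in
/-- `P(F, G)`: the number of `|V(F)|`-subsets `S` of `V(G)` such that the subgraph of `G` induced
by `S` is isomorphic to `F`. -/
noncomputable def inducedCount {V W : Type*} [Fintype V] [Fintype W]
    (F : SimpleGraph V) (G : SimpleGraph W) : ℕ :=
  (((Finset.univ : Finset W).powersetCard (Fintype.card V)).filter
    fun S : Finset W => Nonempty (G.induce (S : Set W) ≃g F)).card

/-- `p(F, G)`: the induced density of `F` in `G`. (It is only of interest when
`|V(F)| ≤ |V(G)|`; otherwise it is `0 / 0 = 0`.) -/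
noncomputable def inducedDensity {V W : Type*} [Fintype V] [Fintype W]
    (F : SimpleGraph V) (G : SimpleGraph W) : ℝ :=
  (inducedCount F G : ℝ) / ((Fintype.card W).choose (Fintype.card V) : ℝ)

/-- `i_k(F, n)`: the maximum of `p(F, G)` over all `K_k`-free graphs `G` with `n` vertices.
For `2 ≤ k` this is a maximum over a finite non-empty set, see `isGreatest_maxDensity`. -/
noncomputable def maxDensity {V : Type*} [Fintype V] (F : SimpleGraph V) (k n : ℕ) : ℝ :=
  sSup {x : ℝ | ∃ G : SimpleGraph (Fin n), G.CliqueFree k ∧ inducedDensity F G = x}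

/-- `i_k(F) = lim_{n → ∞} i_k(F, n)`. For `2 ≤ k` the limit exists, see `tendsto_maxDensity`. -/
noncomputable def cliqueFreeInducibility {V : Type*} [Fintype V] (F : SimpleGraph V) (k : ℕ) : ℝ :=
  limUnder atTop fun n : ℕ => maxDensity F k n

/-- `F` is inducibility diverse if for every `k` there is `m > k` with `i_k(F) < i_m(F)`.
Here `k ≥ 2`, since no graph with a vertex is `K_0`-free or `K_1`-free. -/
def InducibilityDiverse {V : Type*} [Fintype V] (F : SimpleGraph V) : Prop :=
  ∀ k : ℕ, 2 ≤ k → ∃ m : ℕ, k < m ∧ cliqueFreeInducibility F k < cliqueFreeInducibility F m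

theorem finite_densities {V : Type*} [Fintype V] (F : SimpleGraph V) (k n : ℕ) :
    {x : ℝ | ∃ G : SimpleGraph (Fin n), G.CliqueFree k ∧ inducedDensity F G = x}.Finite := by
  refine (Set.finite_range fun G : SimpleGraph (Fin n) => inducedDensity F G).subset ?_
  rintro x ⟨G, -, rfl⟩
  exact ⟨G, rfl⟩

/-- The maximum in the definition of `i_k(F, n)` is attained. -/
theorem isGreatest_maxDensity {V : Type*} [Fintype V] (F : SimpleGraph V) {k : ℕ} (hk : 2 ≤ k)
    (n : ℕ) :
    IsGreatest {x : ℝ | ∃ G : SimpleGraph (Fin n), G.CliqueFree k ∧ inducedDensity F G = x}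
      (maxDensity F k n) := by
  have hne : {x : ℝ | ∃ G : SimpleGraph (Fin n), G.CliqueFree k ∧ inducedDensity F G = x}.Nonempty :=
    ⟨_, ⊥, SimpleGraph.cliqueFree_bot hk, rfl⟩
  exact ⟨hne.csSup_mem (finite_densities F k n),
    fun x hx => le_csSup (finite_densities F k n).bddAbove hx⟩

theorem inducedDensity_nonneg {V W : Type*} [Fintype V] [Fintype W]
    (F : SimpleGraph V) (G : SimpleGraph W) : 0 ≤ inducedDensity F G := by
  unfold inducedDensity; positivity

theorem maxDensity_nonneg {V : Type*} [Fintype V] (F : SimpleGraph V) (k n : ℕ) :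
    0 ≤ maxDensity F k n := by
  apply Real.sSup_nonneg
  rintro x ⟨G, -, rfl⟩
  exact inducedDensity_nonneg F G

/-- Restricting a graph to the image of an embedding commutes with taking induced subgraphs. -/
noncomputable def induceMapIso {U W : Type*} (G : SimpleGraph W) (e : U ↪ W) (S : Finset U) :
    (G.comap e).induce (S : Set U) ≃g G.induce ((S.map e : Finset W) : Set W) where
  toEquiv := (Equiv.Set.image e (S : Set U) e.injective).trans
    (Equiv.setCongr (Finset.coe_map e S).symm)
  map_rel_iff' := by
    intro a b
    rfl

open scoped Classical in
/-- Induced copies in `G - v` are the induced copies in `G` that avoid `v`. -/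
theorem inducedCount_delete {V : Type*} [Fintype V] (F : SimpleGraph V) {n : ℕ}
    (G : SimpleGraph (Fin (n + 1))) (v : Fin (n + 1)) :
    inducedCount F (G.comap v.succAboveEmb) =
      ((((Finset.univ : Finset (Fin (n + 1))).powersetCard (Fintype.card V)).filter
        fun S : Finset (Fin (n + 1)) => Nonempty (G.induce (S : Set (Fin (n + 1))) ≃g F)).filter (v ∉ ·)).card := by
  unfold inducedCount
  refine Finset.card_bij (fun S _ => S.map v.succAboveEmb) ?_ ?_ ?_
  · intro S hS
    simp only [Finset.mem_filter, Finset.mem_powersetCard, Finset.subset_univ, true_and] at hS ⊢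
    refine ⟨⟨by simpa using hS.1, hS.2.map fun f =>
      (induceMapIso G v.succAboveEmb S).symm.trans f⟩, ?_⟩
    simp [Fin.succAbove_ne]
  · intro S _ T _ h
    exact Finset.map_injective _ h
  · intro T hT
    simp only [Finset.mem_filter, Finset.mem_powersetCard, Finset.subset_univ, true_and] at hT
    have hTe : ((Finset.univ.filter fun u => v.succAboveEmb u ∈ T).map v.succAboveEmb) = T := by
      ext x
      simp only [Finset.mem_map, Finset.mem_filter, Finset.mem_univ, true_and]
      constructor
      · rintro ⟨u, hu, rfl⟩
        exact hu
      · intro hx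
        have hxv : x ≠ v := fun h => hT.2 (h ▸ hx)
        obtain ⟨u, rfl⟩ := Fin.exists_succAbove_eq hxv
        exact ⟨u, hx, rfl⟩
    refine ⟨Finset.univ.filter fun u => v.succAboveEmb u ∈ T, ?_, hTe⟩
    simp only [Finset.mem_filter, Finset.mem_powersetCard, Finset.subset_univ, true_and]
    refine ⟨?_, ?_⟩
    · rw [← Finset.card_map v.succAboveEmb, hTe]
      exact hT.1.1
    · have h2 := hT.1.2
      rw [← hTe] at h2
      exact h2.map fun f => (induceMapIso G v.succAboveEmb _).trans f

/-- Double counting of pairs (vertex, induced copy avoiding it). -/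
theorem sum_inducedCount_delete {V : Type*} [Fintype V] (F : SimpleGraph V) {n : ℕ}
    (G : SimpleGraph (Fin (n + 1))) :
    ∑ v : Fin (n + 1), inducedCount F (G.comap v.succAboveEmb) =
      inducedCount F G * (n + 1 - Fintype.card V) := by
  classical
  simp_rw [inducedCount_delete, Finset.card_filter (fun S : Finset (Fin (n + 1)) => _ ∉ S)]
  rw [Finset.sum_comm]
  unfold inducedCount
  rw [← smul_eq_mul, ← Finset.sum_const]
  · refine Finset.sum_congr (by congr) ?_
    intro S hS
    simp only [Finset.mem_filter, Finset.mem_powersetCard] at hS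
    rw [← Finset.card_filter, ← hS.1.2]
    have : (Finset.univ.filter fun v => v ∉ S) = Sᶜ := by ext; simp
    rw [this, Finset.card_compl, Fintype.card_fin]

theorem maxDensity_succ_le {V : Type*} [Fintype V] (F : SimpleGraph V) {k : ℕ} (hk : 2 ≤ k)
    {n : ℕ} (hn : Fintype.card V ≤ n) : maxDensity F k (n + 1) ≤ maxDensity F k n := by
  obtain ⟨G, hG, hGx⟩ := (isGreatest_maxDensity F hk (n + 1)).1
  rw [← hGx]
  set r := Fintype.card V with hr
  have hc : (0 : ℝ) < (n.choose r : ℝ) := by exact_mod_cast Nat.choose_pos hn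
  have hc' : (0 : ℝ) < ((n + 1).choose r : ℝ) := by
    exact_mod_cast Nat.choose_pos (hn.trans n.le_succ)
  have hdel : ∀ v : Fin (n + 1), (inducedCount F (G.comap v.succAboveEmb) : ℝ) ≤
      maxDensity F k n * (n.choose r : ℝ) := by
    intro v
    have h1 : inducedDensity F (G.comap v.succAboveEmb) ≤ maxDensity F k n :=
      (isGreatest_maxDensity F hk n).2
        ⟨_, hG.comap (SimpleGraph.Embedding.comap v.succAboveEmb G).isContained, rfl⟩
    rw [inducedDensity, Fintype.card_fin, div_le_iff₀ hc] at h1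
    exact h1
  have hsum : (inducedCount F G : ℝ) * ((n + 1 - r : ℕ) : ℝ) ≤
      ((n + 1 : ℕ) : ℝ) * (maxDensity F k n * (n.choose r : ℝ)) := by
    have h2 := Finset.sum_le_sum fun v (_ : v ∈ (Finset.univ : Finset (Fin (n + 1)))) => hdel v
    rw [Finset.sum_const, Finset.card_univ, Fintype.card_fin, nsmul_eq_mul] at h2
    have h3 := sum_inducedCount_delete F G
    rw [← Nat.cast_sum, h3, Nat.cast_mul] at h2
    exact h2
  have hch : ((n + 1 : ℕ) : ℝ) * (n.choose r : ℝ) =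
      ((n + 1).choose r : ℝ) * ((n + 1 - r : ℕ) : ℝ) := by
    have := Nat.choose_mul_succ_eq n r
    rw [mul_comm] at this
    exact_mod_cast this
  have hpos : (0 : ℝ) < ((n + 1 - r : ℕ) : ℝ) := by
    have : 0 < n + 1 - r := by omega
    exact_mod_cast this
  rw [inducedDensity, Fintype.card_fin, div_le_iff₀ hc']
  refine le_of_mul_le_mul_right ?_ hpos
  calc _ ≤ _ := hsum
    _ = maxDensity F k n * (((n + 1 : ℕ) : ℝ) * (n.choose r : ℝ)) := by ring
    _ = _ := by rw [hch]; ring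

/-- The limit in the definition of `i_k(F)` exists. -/
theorem tendsto_maxDensity {V : Type*} [Fintype V] (F : SimpleGraph V) {k : ℕ} (hk : 2 ≤ k) :
    Tendsto (fun n : ℕ => maxDensity F k n) atTop (𝓝 (cliqueFreeInducibility F k)) := by
  apply tendsto_nhds_limUnder
  have hanti : Antitone fun n : ℕ => maxDensity F k (n + Fintype.card V) := by
    refine antitone_nat_of_succ_le fun n => ?_
    have := maxDensity_succ_le F hk (Nat.le_add_left (Fintype.card V) n)
    rwa [Nat.add_right_comm] at this
  have hb : BddBelow (Set.range fun n : ℕ => maxDensity F k (n + Fintype.card V)) :=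
    ⟨0, by rintro _ ⟨n, rfl⟩; exact maxDensity_nonneg F k _⟩
  exact ⟨_, (tendsto_add_atTop_iff_nat (Fintype.card V)).1 (tendsto_atTop_ciInf hanti hb)⟩

end Inducibility

namespace SimpleGraph

open Inducibility Filter Topology Asymptotics

variable {V W : Type*}

/-! Up to the factor `s! / |Aut F|`, with `s` the number of vertices of `F`, densities of induced
copies are controlled by `blowupDensity`, the probability that a random map pulls `G` back to `F`.

For a Turán graph `F` with `r < s`, the uniformly weighted complete graphs are optimal. Moving
weight between two non-adjacent vertices in one of the two directions does not lower the density
(`blowupDensity_le_of_not_adj`, which uses that `F` is complete multipartite), and the emptied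
vertex can be deleted. On a complete graph, the density at a weight is at most a convex combination
of the densities after merging two weights and after averaging them (`blowupDensity_top_le`, which
uses that the part sizes differ by at most one). So at a non-uniform maximizer merging loses
nothing, and again a vertex disappears. The density of `F` in uniform `K_N` is at most `1 / N`, so
some `N` is best. Blow-ups of that `K_N` are `K_{N+1}`-free and attain the bound valid for all
graphs, so `i_m(F) ≤ i_{N+1}(F)` for all `m > N + 1`.

For `F = K_s`, no `i_k` reaches `1`, since a large `K_k`-free graph has a non-adjacent pair, while
blow-ups of `K_N` give densities tending to `1`. -/

/-! ### Blow-up densities -/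

open scoped Classical in
/-- The density of `F` in the blow-up of `G` with vertex weights `x`: the sum of the weights of all
(not necessarily injective) maps `f` such that `f` pulls `G` back to `F`. -/
noncomputable def blowupDensity [Fintype V] [Fintype W] (F : SimpleGraph V) (G : SimpleGraph W) (x : W → ℝ) : ℝ :=
  ∑ f : V → W, if G.comap f = F then ∏ v, x (f v) else 0

theorem comap_eq_iff {F : SimpleGraph V} {G : SimpleGraph W} {f : V → W} :
    G.comap f = F ↔ ∀ u v, G.Adj (f u) (f v) ↔ F.Adj u v := by
  constructor
  · rintro rfl u v
    rfl
  · intro h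
    ext u v
    exact h u v

open scoped Classical in
theorem continuous_blowupDensity [Fintype V] [Fintype W] (F : SimpleGraph V) (G : SimpleGraph W) :
    Continuous (blowupDensity F G) := by
  unfold blowupDensity
  refine continuous_finsetSum _ fun f _ => ?_
  split_ifs <;> fun_prop

-- A map leaving the range of `e` picks up a zero factor. This is what allows vertices of weight
-- zero to be deleted.
open scoped Classical in
theorem blowupDensity_comap_embedding [Fintype V] [Fintype W] (F : SimpleGraph V)
    (G : SimpleGraph W) {U : Type*} [Fintype U] (e : U ↪ W) {x : W → ℝ} (hx : ∀ w, w ∉ Set.range e → x w = 0) :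
    blowupDensity F (G.comap e) (x ∘ e) = blowupDensity F G x := by
  unfold blowupDensity
  refine Finset.sum_of_injOn (fun f => e ∘ f) (e.injective.comp_left.injOn) (by simp) ?_ ?_
  · intro f _ hf
    have : ∃ v, f v ∉ Set.range e := by
      by_contra! h
      choose g hg using h
      exact hf ⟨g, by simp, funext hg⟩
    obtain ⟨v, hv⟩ := this
    rw [Finset.prod_eq_zero (Finset.mem_univ v) (hx _ hv), ite_self]
  · intro f _
    rfl

open scoped Classical in
theorem blowupDensity_comp_perm [Fintype V] [Fintype W] (F : SimpleGraph V) (G : SimpleGraph W) (x : W → ℝ)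
    (τ : Equiv.Perm W) :
    blowupDensity F G (x ∘ τ) =
      ∑ f : V → W, if G.comap (τ.symm ∘ f) = F then ∏ v, x (f v) else 0 := by
  unfold blowupDensity
  refine Fintype.sum_equiv (Equiv.arrowCongr (Equiv.refl V) τ) _ _ fun f => ?_
  have : τ.symm ∘ (Equiv.arrowCongr (Equiv.refl V) τ) f = f := by ext; simp
  rw [this]
  simp

/-! ### Symmetrization over non-adjacent vertices -/

section Merge

variable [DecidableEq W]

/-- The map sending `q` to `p` and fixing everything else. -/
def mergeInto (p q : W) (w : W) : W := if w = q then p else w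

/-- The weight function obtained from `x` by moving the weight of `q` to `p`. -/
def shiftWeight (x : W → ℝ) (p q : W) (w : W) : ℝ :=
  if w = q then 0 else if w = p then x p + x q else x w

/-- A vertex mapped to `q` is a non-neighbour of `a`. Non-adjacency in `F` is transitive, so the two
have the same neighbours in `F`, and redirecting from `q` to `p` changes no adjacency. -/
theorem comap_mergeInto_comp {F : SimpleGraph V} (hF : F.IsCompleteMultipartite)
    {G : SimpleGraph W} {p q : W} (hpq : ¬ G.Adj p q) {f : V → W} (hf : G.comap f = F) {a : V}
    (ha : f a = p) : G.comap (mergeInto p q ∘ f) = F := by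
  rw [comap_eq_iff] at hf ⊢
  have key : ∀ u v, f u = q → (G.Adj p (f v) ↔ F.Adj u v) := by
    intro u v hu
    rw [← ha, hf]
    have hau : ¬ F.Adj a u := by rwa [← hf, ha, hu]
    have hua : ¬ F.Adj u a := fun h => hau h.symm
    constructor
    · intro h
      by_contra h'
      exact hF.trans _ _ _ hau h' h
    · intro h
      by_contra h'
      exact hF.trans _ _ _ hua h' h
  intro u v
  by_cases hu : f u = q <;> by_cases hv : f v = q
  · rw [← hf, hu, hv]
    simp [mergeInto, hu, hv]
  · simpa [mergeInto, hu, hv] using key u v hu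
  · simpa [mergeInto, hu, hv, G.adj_comm, F.adj_comm] using key v u hv
  · simpa [mergeInto, hu, hv] using hf u v

theorem shiftWeight_nonneg {x : W → ℝ} (hx : ∀ w, 0 ≤ x w) (p q w : W) :
    0 ≤ shiftWeight x p q w := by
  unfold shiftWeight
  split_ifs
  · rfl
  · exact add_nonneg (hx _) (hx _)
  · exact hx _

theorem sum_shiftWeight [Fintype W] (x : W → ℝ) {p q : W} (hpq : p ≠ q) :
    ∑ w, shiftWeight x p q w = ∑ w, x w := by
  have h : ∀ w, shiftWeight x p q w = x w + ((if w = p then x q else 0) - if w = q then x q else 0) := by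
    intro w
    unfold shiftWeight
    split_ifs with h1 h2 h2
    · exact absurd (h2.symm.trans h1) hpq
    · simp [h1]
    · simp [h2]
    · simp
  simp_rw [h, Finset.sum_add_distrib, Finset.sum_sub_distrib]
  simp

theorem shiftWeight_comp_swap (x : W → ℝ) {p q : W} (hpq : p ≠ q) :
    shiftWeight x p q ∘ Equiv.swap p q = shiftWeight x q p := by
  ext w
  simp only [Function.comp, shiftWeight, Equiv.swap_apply_def]
  split_ifs <;> simp_all [add_comm]

open scoped Classical in
/-- Symmetrization: weight can be moved between non-adjacent vertices. -/
theorem blowupDensity_le_of_not_adj [Fintype V] [Fintype W] {F : SimpleGraph V} (hF : F.IsCompleteMultipartite)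
    {G : SimpleGraph W} {p q : W} (hne : p ≠ q) (hpq : ¬ G.Adj p q) {x : W → ℝ}
    (hx : ∀ w, 0 ≤ x w) :
    (x p + x q) * blowupDensity F G x ≤
      x p * blowupDensity F G (shiftWeight x p q) + x q * blowupDensity F G (shiftWeight x q p) := by
  rw [← shiftWeight_comp_swap x hne, blowupDensity_comp_perm]
  -- Maps are grouped by their merged map `h`, and the inequality is proved on each group
  -- separately.
  have hfib : blowupDensity F G x = ∑ h : V → W,
      ∑ f : V → W with mergeInto p q ∘ f = h, if G.comap f = F then ∏ v, x (f v) else 0 := by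
    rw [Finset.sum_fiberwise]
    rfl
  rw [hfib]
  unfold blowupDensity
  rw [Finset.mul_sum, Finset.mul_sum, Finset.mul_sum, ← Finset.sum_add_distrib]
  refine Finset.sum_le_sum fun h _ => ?_
  rw [Equiv.symm_swap]
  set y := shiftWeight x p q with hy
  have hy0 : ∀ w, 0 ≤ y w := shiftWeight_nonneg hx p q
  have hW0 : 0 ≤ ∏ v, y (h v) := Finset.prod_nonneg fun v _ => hy0 _
  have hw0 : ∀ f : V → W, 0 ≤ ∏ v, x (f v) := fun f => Finset.prod_nonneg fun v _ => hx _
  have hrhs : 0 ≤ x p * (if G.comap h = F then ∏ v, y (h v) else 0) +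
      x q * (if G.comap (Equiv.swap p q ∘ h) = F then ∏ v, y (h v) else 0) := by
    have := hx p
    have := hx q
    split_ifs <;> positivity
  by_cases hq : ∃ v, h v = q
  · obtain ⟨v, hv⟩ := hq
    rw [Finset.filter_eq_empty_iff.2, Finset.sum_empty, mul_zero]
    · exact hrhs
    · rintro f - rfl
      simp only [mergeInto, Function.comp] at hv
      split_ifs at hv with h1
      · exact hne hv
      · exact h1 hv
  push Not at hq
  have htotal : ∑ f : V → W with mergeInto p q ∘ f = h, ∏ v, x (f v) = ∏ v, y (h v) := by
    have : ∀ v, y (h v) = ∑ w with mergeInto p q w = h v, x w := by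
      intro v
      rw [hy, shiftWeight, if_neg (hq v)]
      split_ifs with h1
      · have : (Finset.univ.filter fun w => mergeInto p q w = h v) = {p, q} := by
          ext w
          simp only [mergeInto, Finset.mem_filter, Finset.mem_univ, true_and, Finset.mem_insert,
            Finset.mem_singleton, h1]
          split_ifs with h2 <;> simp [h2]
        rw [this, Finset.sum_pair hne]
      · have : (Finset.univ.filter fun w => mergeInto p q w = h v) = {h v} := by
          ext w
          rw [Finset.mem_filter, Finset.mem_singleton, mergeInto]
          simp only [Finset.mem_univ, true_and]
          split_ifs with h2
          · exact ⟨fun h3 => absurd h3.symm h1, fun h3 => absurd (h3.symm.trans h2) (hq v)⟩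
          · rfl
        rw [this, Finset.sum_singleton]
    simp_rw [this]
    rw [Finset.prod_univ_sum]
    refine Finset.sum_congr ?_ fun _ _ => rfl
    ext f
    simp [funext_iff]
  -- A map that meets both of `p` and `q`, or neither, stays good under both merges. One that meets
  -- only one of them equals `h` or its swap.
  have hkey : ∀ f : V → W, mergeInto p q ∘ f = h → G.comap f = F →
      (G.comap h = F ∧ G.comap (Equiv.swap p q ∘ h) = F) ∨
        (f = h ∧ ∃ v, h v = p) ∨ (f = Equiv.swap p q ∘ h ∧ ∃ v, h v = p) := by
    rintro f rfl hf
    have hswap : Equiv.swap p q ∘ mergeInto p q ∘ f = mergeInto q p ∘ f := by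
      ext v
      simp only [Function.comp, mergeInto, Equiv.swap_apply_def]
      split_ifs <;> simp_all
    rw [hswap]
    by_cases hp' : ∃ a, f a = p <;> by_cases hq' : ∃ b, f b = q
    · obtain ⟨a, ha⟩ := hp'
      obtain ⟨b, hb⟩ := hq'
      exact Or.inl ⟨comap_mergeInto_comp hF hpq hf ha,
        comap_mergeInto_comp hF (fun h => hpq h.symm) hf hb⟩
    · obtain ⟨a, ha⟩ := hp'
      push Not at hq'
      refine Or.inr (Or.inl ⟨?_, a, ?_⟩)
      · ext v
        simp [mergeInto, hq' v]
      · simp [mergeInto, ha]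
    · obtain ⟨b, hb⟩ := hq'
      push Not at hp'
      refine Or.inr (Or.inr ⟨?_, b, ?_⟩)
      · ext v
        simp [mergeInto, hp' v]
      · simp [mergeInto, hb]
    · push Not at hp' hq'
      have h1 : mergeInto p q ∘ f = f := by ext v; simp [mergeInto, hq' v]
      have h2 : mergeInto q p ∘ f = f := by ext v; simp [mergeInto, hp' v]
      rw [h1, h2]
      exact Or.inl ⟨hf, hf⟩
  -- The factor at one vertex `a` over `p` supplies exactly `x p + x q`; the remaining factors are
  -- compared termwise.
  have hyp : y p = x p + x q := by simp [hy, shiftWeight, hne]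
  have hbound : ∀ (f : V → W) (a : V), h a = p → (∀ v, x (f v) ≤ y (h v)) →
      (x p + x q) * ∏ v, x (f v) ≤ x (f a) * ∏ v, y (h v) := by
    intro f a ha hle
    rw [← Finset.mul_prod_erase _ _ (Finset.mem_univ a),
      ← Finset.mul_prod_erase _ (fun v => y (h v)) (Finset.mem_univ a), ha, hyp]
    have h1 : ∏ v ∈ Finset.univ.erase a, x (f v) ≤ ∏ v ∈ Finset.univ.erase a, y (h v) :=
      Finset.prod_le_prod (fun v _ => hx _) fun v _ => hle v
    have h2 : 0 ≤ (x p + x q) * x (f a) := mul_nonneg (add_nonneg (hx _) (hx _)) (hx _)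
    nlinarith [mul_le_mul_of_nonneg_left h1 h2]
  have hle1 : ∀ v, x (h v) ≤ y (h v) := by
    intro v
    simp only [hy, shiftWeight, if_neg (hq v)]
    split_ifs with h1
    · rw [h1]; linarith [hx q]
    · exact le_rfl
  have hle2 : ∀ v, x ((Equiv.swap p q ∘ h) v) ≤ y (h v) := by
    intro v
    simp only [hy, shiftWeight, if_neg (hq v), Function.comp, Equiv.swap_apply_def]
    split_ifs with h1
    · linarith [hx p]
    · exact le_rfl
  -- Used when just one of `h` and its swap is good and `h` meets `p`: then the group contains at
  -- most one good map.
  have hsingle : ∀ f₀ : V → W, (∀ f : V → W, mergeInto p q ∘ f = h → G.comap f = F → f = f₀) →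
      ∑ f : V → W with mergeInto p q ∘ f = h, (if G.comap f = F then ∏ v, x (f v) else 0) ≤
        ∏ v, x (f₀ v) := by
    intro f₀ hf₀
    calc _ ≤ ∑ f : V → W, if f = f₀ then ∏ v, x (f₀ v) else 0 := by
          rw [Finset.sum_filter]
          refine Finset.sum_le_sum fun f _ => ?_
          by_cases hff : f = f₀
          · rw [if_pos hff, hff]
            split_ifs <;> first | exact le_rfl | exact hw0 f₀
          · rw [if_neg hff]
            split_ifs with h3 h4
            · exact absurd (hf₀ f h3 h4) hff
            · rfl
            · rfl
      _ = _ := by simp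
  have hfix : (¬ ∃ v, h v = p) → Equiv.swap p q ∘ h = h := by
    intro hv
    push Not at hv
    ext v
    simp [Equiv.swap_apply_of_ne_of_ne (hv v) (hq v)]
  by_cases h1 : G.comap h = F <;> by_cases h2 : G.comap (Equiv.swap p q ∘ h) = F
  · rw [if_pos h1, if_pos h2, ← add_mul, ← htotal]
    refine mul_le_mul_of_nonneg_left (Finset.sum_le_sum fun f _ => ?_) (add_nonneg (hx _) (hx _))
    split_ifs
    · exact le_rfl
    · exact hw0 f
  · rw [if_pos h1, if_neg h2, mul_zero, add_zero]
    by_cases hv : ∃ v, h v = p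
    · obtain ⟨a, ha⟩ := hv
      have := hbound h a ha hle1
      rw [ha] at this
      refine le_trans (mul_le_mul_of_nonneg_left ?_ (add_nonneg (hx _) (hx _))) this
      refine hsingle h fun f h3 h4 => ?_
      rcases hkey f h3 h4 with h5 | h5 | h5
      · exact absurd h5.2 h2
      · exact h5.1
      · exact absurd (h5.1 ▸ h4) h2
    · rw [hfix hv] at h2
      exact absurd h1 h2
  · rw [if_neg h1, if_pos h2, mul_zero, zero_add]
    by_cases hv : ∃ v, h v = p
    · obtain ⟨a, ha⟩ := hv
      have := hbound (Equiv.swap p q ∘ h) a ha hle2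
      rw [show (Equiv.swap p q ∘ h) a = q by simp [ha]] at this
      refine le_trans (mul_le_mul_of_nonneg_left ?_ (add_nonneg (hx _) (hx _))) this
      refine hsingle _ fun f h3 h4 => ?_
      rcases hkey f h3 h4 with h5 | h5 | h5
      · exact absurd h5.1 h1
      · exact absurd (h5.1 ▸ h4) h1
      · exact h5.1
    · rw [hfix hv] at h2
      exact absurd h2 h1
  · refine le_trans (le_of_eq ?_) hrhs
    rw [Finset.sum_eq_zero, mul_zero]
    intro f hf
    rw [Finset.mem_filter] at hf
    refine if_neg fun h4 => ?_
    rcases hkey f hf.2 h4 with h5 | h5 | h5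
    · exact h1 h5.1
    · exact h1 (h5.1 ▸ h4)
    · exact h2 (h5.1 ▸ h4)

end Merge

/-! ### A chord inequality for symmetrized monomials -/

/-- The first bound is the chord, in the variable `d ^ 2`, between `d ^ 2 = 0` and `d ^ 2 = 1`. The
second controls the cross term when the exponent grows, so both are carried through one induction.
-/
theorem one_add_pow_add_one_sub_pow_le {d : ℝ} (hd : d ^ 2 ≤ 1) (a : ℕ) :
    (1 + d) ^ (a + 1) + (1 - d) ^ (a + 1) ≤ 2 + (2 ^ (a + 1) - 2) * d ^ 2 ∧
      d * ((1 + d) ^ (a + 1) - (1 - d) ^ (a + 1)) ≤ 2 ^ (a + 1) * d ^ 2 := by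
  induction a with
  | zero => constructor <;> exact le_of_eq (by ring)
  | succ a ih =>
    obtain ⟨h1, h2⟩ := ih
    have h3 : (2 : ℝ) ≤ 2 ^ (a + 1) := by
      rw [pow_succ]
      linarith [one_le_pow₀ (one_le_two (α := ℝ)) (n := a)]
    have h4 : (1 + d) ^ (a + 1) + (1 - d) ^ (a + 1) ≤ 2 ^ (a + 1) := by
      nlinarith
    rw [pow_succ (1 + d) (a + 1), pow_succ (1 - d) (a + 1), pow_succ 2 (a + 1)]
    constructor
    · nlinarith
    · nlinarith [mul_le_mul_of_nonneg_left h4 (sq_nonneg d)]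

/-- This is the preceding bound at `d = (x - y) / (x + y)`, with denominators cleared. -/
theorem sq_mul_pow_add_pow_le {x y : ℝ} (hx : 0 ≤ x) (hy : 0 ≤ y) (a : ℕ) :
    (x + y) ^ 2 * (x ^ (a + 1) + y ^ (a + 1)) ≤
      (x - y) ^ 2 * (x + y) ^ (a + 1) + 4 * (x * y) * (2 * ((x + y) / 2) ^ (a + 1)) := by
  rcases (add_nonneg hx hy).eq_or_lt with h0 | hc
  · have hx0 : x = 0 := by linarith
    have hy0 : y = 0 := by linarith
    simp [hx0, hy0]
  have hd : ((x - y) / (x + y)) ^ 2 ≤ 1 := by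
    rw [div_pow, div_le_one (by positivity)]
    nlinarith [mul_nonneg hx hy]
  have h1 := (one_add_pow_add_one_sub_pow_le hd a).1
  have e1 : 1 + (x - y) / (x + y) = x * (2 / (x + y)) := by field_simp; ring
  have e2 : 1 - (x - y) / (x + y) = y * (2 / (x + y)) := by field_simp; ring
  rw [e1, e2, mul_pow, mul_pow, ← add_mul, div_pow, div_pow] at h1
  have hp : 0 < (x + y) ^ 2 * ((x + y) ^ (a + 1) / 2 ^ (a + 1)) := by positivity
  have h2 := mul_le_mul_of_nonneg_left h1 hp.le
  have e3 : (x + y) ^ 2 * ((x + y) ^ (a + 1) / 2 ^ (a + 1)) *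
      ((x ^ (a + 1) + y ^ (a + 1)) * (2 ^ (a + 1) / (x + y) ^ (a + 1))) =
      (x + y) ^ 2 * (x ^ (a + 1) + y ^ (a + 1)) := by
    field_simp
  have e4 : (x + y) ^ 2 * ((x + y) ^ (a + 1) / 2 ^ (a + 1)) *
      (2 + (2 ^ (a + 1) - 2) * ((x - y) ^ 2 / (x + y) ^ 2)) =
      (x - y) ^ 2 * (x + y) ^ (a + 1) + 4 * (x * y) * (2 * ((x + y) / 2) ^ (a + 1)) := by
    rw [div_pow]
    field_simp
    ring
  rwa [e3, e4] at h2

/-- AM-GM is applied to all but one of the factors `x * y`. -/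
theorem sq_mul_mul_pow_le {x y : ℝ} (hx : 0 ≤ x) (hy : 0 ≤ y) (m : ℕ) :
    (x + y) ^ 2 * (x * y) ^ (m + 1) ≤ 4 * (x * y) * ((x + y) / 2) ^ (2 * (m + 1)) := by
  have hu : x * y ≤ ((x + y) / 2) ^ 2 := by nlinarith [sq_nonneg (x - y)]
  have hxy := mul_nonneg hx hy
  have h1 := mul_le_mul_of_nonneg_left (pow_le_pow_left₀ hxy hu m)
    (mul_nonneg (sq_nonneg (x + y)) hxy)
  calc _ = (x + y) ^ 2 * (x * y) * (x * y) ^ m := by ring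
    _ ≤ _ := h1
    _ = _ := by rw [pow_mul]; ring

/-- The symmetrized monomial `x ^ a * y ^ b` is convex as a function of `(x - y) ^ 2` when `x + y`
is fixed, provided that `a = 0`, `b = 0` or `|a - b| ≤ 1`. -/
theorem sq_mul_symm_monomial_le {x y : ℝ} (hx : 0 ≤ x) (hy : 0 ≤ y) {a b : ℕ}
    (hab : a = 0 ∨ b = 0 ∨ (a ≤ b + 1 ∧ b ≤ a + 1)) :
    (x + y) ^ 2 * (x ^ a * y ^ b + y ^ a * x ^ b) ≤
      (x - y) ^ 2 * ((x + y) ^ a * 0 ^ b + 0 ^ a * (x + y) ^ b) +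
        4 * (x * y) * (((x + y) / 2) ^ a * ((x + y) / 2) ^ b + ((x + y) / 2) ^ a * ((x + y) / 2) ^ b) := by
  rcases a with _ | a <;> rcases b with _ | b
  -- Here `0 ^ 0 = 1`, and both sides agree because `(x + y) ^ 2 = (x - y) ^ 2 + 4 * (x * y)`.
  · simp only [pow_zero]
    nlinarith
  · have := sq_mul_pow_add_pow_le hx hy b
    simp only [pow_zero, one_mul, zero_pow (Nat.succ_ne_zero b), zero_add]
    linarith
  · have := sq_mul_pow_add_pow_le hx hy a
    simp only [pow_zero, mul_one, zero_pow (Nat.succ_ne_zero a), add_zero]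
    linarith
  · have h : a = b ∨ a = b + 1 ∨ b = a + 1 := by omega
    simp only [zero_pow (Nat.succ_ne_zero a), zero_pow (Nat.succ_ne_zero b), mul_zero, zero_mul,
      add_zero, zero_add]
    have hc := add_nonneg hx hy
    rcases h with rfl | rfl | rfl
    · have := sq_mul_mul_pow_le hx hy a
      calc _ = 2 * ((x + y) ^ 2 * (x * y) ^ (a + 1)) := by ring
        _ ≤ _ := mul_le_mul_of_nonneg_left this zero_le_two
        _ = _ := by ring
    · have := sq_mul_mul_pow_le hx hy b
      calc _ = (x + y) * ((x + y) ^ 2 * (x * y) ^ (b + 1)) := by ring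
        _ ≤ _ := mul_le_mul_of_nonneg_left this hc
        _ = _ := by ring
    · have := sq_mul_mul_pow_le hx hy a
      calc _ = (x + y) * ((x + y) ^ 2 * (x * y) ^ (a + 1)) := by ring
        _ ≤ _ := mul_le_mul_of_nonneg_left this hc
        _ = _ := by ring

/-! ### Averaging weights on complete graphs -/

/-- `F` is balanced if the numbers of non-neighbours of any two vertices differ by at most one. -/
def IsBalanced [Fintype V] (F : SimpleGraph V) : Prop :=
  ∀ u v, {w | ¬ F.Adj u w}.ncard ≤ {w | ¬ F.Adj v w}.ncard + 1

section Average

variable [DecidableEq W]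

/-- The weight function obtained from `x` by averaging over `p` and `q`. -/
noncomputable def averageWeight (x : W → ℝ) (p q : W) (w : W) : ℝ :=
  if w = p ∨ w = q then (x p + x q) / 2 else x w

theorem averageWeight_nonneg {x : W → ℝ} (hx : ∀ w, 0 ≤ x w) (p q w : W) :
    0 ≤ averageWeight x p q w := by
  unfold averageWeight
  split_ifs
  · exact div_nonneg (add_nonneg (hx _) (hx _)) zero_le_two
  · exact hx _

theorem sum_averageWeight [Fintype W] (x : W → ℝ) {p q : W} (hpq : p ≠ q) :
    ∑ w, averageWeight x p q w = ∑ w, x w := by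
  have h : ∀ w, averageWeight x p q w =
      x w + ((if w = p then (x q - x p) / 2 else 0) - if w = q then (x q - x p) / 2 else 0) := by
    intro w
    unfold averageWeight
    by_cases h1 : w = p <;> by_cases h2 : w = q
    · exact absurd (h1.symm.trans h2) hpq
    · simp [h1, hpq]; ring
    · simp [h2, hpq.symm]; ring
    · simp [h1, h2]
  simp_rw [h, Finset.sum_add_distrib, Finset.sum_sub_distrib]
  simp

theorem prod_comp_eq_pow_mul_pow [Fintype V] {p q : W} (hpq : p ≠ q) (f : V → W) (z : W → ℝ) :
    ∏ v, z (f v) = z p ^ (Finset.univ.filter fun v => f v = p).card *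
      z q ^ (Finset.univ.filter fun v => f v = q).card *
        ∏ v, if f v = p ∨ f v = q then 1 else z (f v) := by
  rw [← Finset.prod_const, ← Finset.prod_const, Finset.prod_filter, Finset.prod_filter,
    ← Finset.prod_mul_distrib, ← Finset.prod_mul_distrib]
  refine Finset.prod_congr rfl fun v _ => ?_
  by_cases h1 : f v = p <;> by_cases h2 : f v = q
  · exact absurd (h1.symm.trans h2) hpq
  · simp [h1, hpq]
  · simp [h2, hpq.symm]
  · simp [h1, h2]

-- Complete graphs are invariant under swapping `p` and `q`; the doubled sum has terms symmetric in
-- the two weights, as the monomial inequality requires.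
open scoped Classical in
theorem two_mul_blowupDensity_top [Fintype V] [Fintype W] (F : SimpleGraph V) (x : W → ℝ) (p q : W) :
    2 * blowupDensity F ⊤ x = ∑ f : V → W, if (⊤ : SimpleGraph W).comap f = F then
      (∏ v, x (f v)) + ∏ v, x (Equiv.swap p q (f v)) else 0 := by
  have h1 : blowupDensity F ⊤ (x ∘ Equiv.swap p q) = blowupDensity F ⊤ x := by
    rw [blowupDensity_comp_perm]
    unfold blowupDensity
    refine Finset.sum_congr rfl fun f _ => ?_
    have : (⊤ : SimpleGraph W).comap ((Equiv.swap p q).symm ∘ f) = (⊤ : SimpleGraph W).comap f := by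
      ext u v
      simp
    rw [this]
  rw [two_mul]
  nth_rewrite 2 [← h1]
  unfold blowupDensity
  rw [← Finset.sum_add_distrib]
  refine Finset.sum_congr rfl fun f _ => ?_
  split_ifs
  · rfl
  · exact add_zero 0

-- The coefficients on the right add up to `(x p + x q) ^ 2`, so this is a convex combination when
-- that is positive. It holds map by map: the exponents of `x p` and `x q` are sizes of fibres, and
-- non-empty fibres are parts of `F`.
open scoped Classical in
theorem blowupDensity_top_le [Fintype V] [Fintype W] {F : SimpleGraph V} (hF : F.IsBalanced)
    {p q : W} (hpq : p ≠ q) {x : W → ℝ} (hx : ∀ w, 0 ≤ x w) :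
    (x p + x q) ^ 2 * blowupDensity F ⊤ x ≤
      (x p - x q) ^ 2 * blowupDensity F ⊤ (shiftWeight x p q) +
        4 * (x p * x q) * blowupDensity F ⊤ (averageWeight x p q) := by
  suffices h : (x p + x q) ^ 2 * (2 * blowupDensity F ⊤ x) ≤
      (x p - x q) ^ 2 * (2 * blowupDensity F ⊤ (shiftWeight x p q)) +
        4 * (x p * x q) * (2 * blowupDensity F ⊤ (averageWeight x p q)) by linarith
  rw [two_mul_blowupDensity_top F _ p q, two_mul_blowupDensity_top F _ p q,
    two_mul_blowupDensity_top F _ p q, Finset.mul_sum, Finset.mul_sum, Finset.mul_sum,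
    ← Finset.sum_add_distrib]
  refine Finset.sum_le_sum fun f _ => ?_
  split_ifs with hf
  swap
  · simp
  set a := (Finset.univ.filter fun v => f v = p).card with ha
  set b := (Finset.univ.filter fun v => f v = q).card with hb
  set R := ∏ v, if f v = p ∨ f v = q then 1 else x (f v) with hR
  have hR0 : 0 ≤ R := Finset.prod_nonneg fun v _ => by
    split_ifs
    · exact zero_le_one
    · exact hx _
  have key : ∀ z : W → ℝ, (∀ w, w ≠ p → w ≠ q → z w = x w) →
      (∏ v, z (f v)) + ∏ v, z (Equiv.swap p q (f v)) = (z p ^ a * z q ^ b + z q ^ a * z p ^ b) * R := by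
    intro z hz
    have h1 := prod_comp_eq_pow_mul_pow hpq f z
    have h2 := prod_comp_eq_pow_mul_pow hpq f (z ∘ Equiv.swap p q)
    simp only [Function.comp, Equiv.swap_apply_left, Equiv.swap_apply_right] at h2
    rw [h1, h2, add_mul]
    congr 2
    · refine Finset.prod_congr rfl fun v _ => ?_
      split_ifs with h
      · rfl
      · push Not at h
        exact hz _ h.1 h.2
    · refine Finset.prod_congr rfl fun v _ => ?_
      split_ifs with h
      · rfl
      · push Not at h
        rw [Equiv.swap_apply_of_ne_of_ne h.1 h.2]
        exact hz _ h.1 h.2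
  have hcard : ∀ u, {w | ¬ F.Adj u w}.ncard = (Finset.univ.filter fun v => f v = f u).card := by
    intro u
    rw [← Set.ncard_coe_finset]
    congr 1
    ext w
    simp [← hf, eq_comm]
  have hab : a = 0 ∨ b = 0 ∨ (a ≤ b + 1 ∧ b ≤ a + 1) := by
    by_cases h1 : ∃ u, f u = p
    · by_cases h2 : ∃ v, f v = q
      · obtain ⟨u, hu⟩ := h1
        obtain ⟨v, hv⟩ := h2
        have h3 := hF u v
        have h4 := hF v u
        rw [hcard, hcard, hu, hv] at h3 h4
        exact Or.inr (Or.inr ⟨h3, h4⟩)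
      · push Not at h2
        exact Or.inr (Or.inl (by simp [hb, h2]))
    · push Not at h1
      exact Or.inl (by simp [ha, h1])
  rw [key x fun _ _ _ => rfl, key (shiftWeight x p q) fun w h1 h2 => by simp [shiftWeight, h1, h2],
    key (averageWeight x p q) fun w h1 h2 => by simp [averageWeight, h1, h2]]
  have e1 : shiftWeight x p q p = x p + x q := by simp [shiftWeight, hpq]
  have e2 : shiftWeight x p q q = 0 := by simp [shiftWeight]
  have e3 : averageWeight x p q p = (x p + x q) / 2 := by simp [averageWeight]
  have e4 : averageWeight x p q q = (x p + x q) / 2 := by simp [averageWeight]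
  rw [e1, e2, e3, e4]
  have := mul_le_mul_of_nonneg_right (sq_mul_symm_monomial_le (hx p) (hx q) hab) hR0
  linarith

end Average

/-! ### Reduction to uniform complete graphs -/

/-- For balanced complete multipartite `F`, uniform blow-ups of complete graphs are optimal. -/
theorem exists_blowupDensity_le_top [Fintype V] {F : SimpleGraph V}
    (hF : F.IsCompleteMultipartite) (hF' : F.IsBalanced) (n : ℕ) (G : SimpleGraph (Fin n))
    {x : Fin n → ℝ} (hx : x ∈ stdSimplex ℝ (Fin n)) :
    ∃ N : ℕ, 1 ≤ N ∧ blowupDensity F G x ≤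
      blowupDensity F (⊤ : SimpleGraph (Fin N)) fun _ => (N : ℝ)⁻¹ := by
  induction n with
  | zero => simpa using hx.2
  | succ n ih =>
    -- A vertex of weight zero is deleted, and the induction hypothesis applies.
    have hzero : ∀ (H : SimpleGraph (Fin (n + 1))) (y : Fin (n + 1) → ℝ) (i : Fin (n + 1)),
        (∀ w, 0 ≤ y w) → ∑ w, y w = 1 → y i = 0 → ∃ N : ℕ, 1 ≤ N ∧ blowupDensity F H y ≤
          blowupDensity F (⊤ : SimpleGraph (Fin N)) fun _ => (N : ℝ)⁻¹ := by
      intro H y i hy0 hy1 hyi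
      rw [← blowupDensity_comap_embedding F H i.succAboveEmb (x := y) (fun w hw => by
        by_contra h
        have hwi : w ≠ i := fun h' => h (h' ▸ hyi)
        obtain ⟨u, rfl⟩ := Fin.exists_succAbove_eq hwi
        exact hw ⟨u, rfl⟩)]
      refine ih _ ⟨fun w => hy0 _, ?_⟩
      rw [Fin.sum_univ_succAbove y i, hyi, zero_add] at hy1
      exact hy1
    by_cases hG : G = ⊤
    -- Passing to a maximizer ensures that averaging cannot increase the density, so the convex
    -- combination forces the merged weight to be at least as good.
    · obtain ⟨m, hm, hmax⟩ := (isCompact_stdSimplex ℝ (Fin (n + 1))).exists_isMaxOn ⟨x, hx⟩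
        (continuous_blowupDensity F (⊤ : SimpleGraph (Fin (n + 1)))).continuousOn
      suffices h : ∃ N : ℕ, 1 ≤ N ∧ blowupDensity F (⊤ : SimpleGraph (Fin (n + 1))) m ≤
          blowupDensity F (⊤ : SimpleGraph (Fin N)) fun _ => (N : ℝ)⁻¹ by
        obtain ⟨N, hN, h⟩ := h
        exact ⟨N, hN, hG ▸ (hmax hx).trans h⟩
      by_cases hz : ∃ i, m i = 0
      · obtain ⟨i, hi⟩ := hz
        exact hzero _ m i hm.1 hm.2 hi
      push Not at hz
      by_cases hconst : ∀ i j, m i = m j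
      · refine ⟨n + 1, by omega, le_of_eq ?_⟩
        congr 1
        ext i
        have h1 := hm.2
        rw [Finset.sum_congr rfl fun j _ => hconst j i, Finset.sum_const, Finset.card_univ,
          Fintype.card_fin, nsmul_eq_mul] at h1
        exact eq_inv_of_mul_eq_one_right h1
      push Not at hconst
      obtain ⟨i, j, hij⟩ := hconst
      have hne : i ≠ j := fun h => hij (h ▸ rfl)
      have h1 := blowupDensity_top_le hF' hne hm.1
      have h2 : blowupDensity F (⊤ : SimpleGraph (Fin (n + 1))) (averageWeight m i j) ≤
          blowupDensity F (⊤ : SimpleGraph (Fin (n + 1))) m :=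
        hmax ⟨averageWeight_nonneg hm.1 i j, (sum_averageWeight m hne).trans hm.2⟩
      obtain ⟨N, hN, h3⟩ := hzero ⊤ (shiftWeight m i j) j (shiftWeight_nonneg hm.1 i j)
        ((sum_shiftWeight m hne).trans hm.2) (by simp [shiftWeight])
      refine ⟨N, hN, le_trans ?_ h3⟩
      have h4 : 0 < (m i - m j) ^ 2 := by
        have : m i - m j ≠ 0 := sub_ne_zero.2 hij
        positivity
      have h5 := mul_le_mul_of_nonneg_left h2 (mul_nonneg (zero_le_four (α := ℝ))
        (mul_nonneg (hm.1 i) (hm.1 j)))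
      refine le_of_mul_le_mul_left ?_ h4
      linarith
    · by_cases hz : ∃ i, x i = 0
      · obtain ⟨i, hi⟩ := hz
        exact hzero _ x i hx.1 hx.2 hi
      push Not at hz
      have : ∃ i j, i ≠ j ∧ ¬ G.Adj i j := by
        by_contra! h
        apply hG
        ext i j
        simp only [top_adj]
        exact ⟨fun h' => h'.ne, h i j⟩
      obtain ⟨i, j, hne, hij⟩ := this
      have h1 := blowupDensity_le_of_not_adj hF hne hij hx.1
      have hi := (hx.1 i).lt_of_ne' (hz i)
      have hj := (hx.1 j).lt_of_ne' (hz j)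
      -- At least one of the two shifts does not decrease the density, and either one frees a
      -- vertex.
      by_cases h2 : blowupDensity F G x ≤ blowupDensity F G (shiftWeight x i j)
      · obtain ⟨N, hN, h3⟩ := hzero G (shiftWeight x i j) j (shiftWeight_nonneg hx.1 i j)
          ((sum_shiftWeight x hne).trans hx.2) (by simp [shiftWeight])
        exact ⟨N, hN, h2.trans h3⟩
      · obtain ⟨N, hN, h3⟩ := hzero G (shiftWeight x j i) i (shiftWeight_nonneg hx.1 j i)
          ((sum_shiftWeight x hne.symm).trans hx.2) (by simp [shiftWeight])
        refine ⟨N, hN, le_trans ?_ h3⟩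
        push Not at h2
        by_contra! h4
        nlinarith [mul_lt_mul_of_pos_left h2 hi, mul_lt_mul_of_pos_left h4 hj]

/-! ### Comparing inducibility with blow-up densities -/

open scoped Classical in
/-- Every induced copy of `F` is the image of exactly `|Aut F|` embeddings. -/
theorem card_inducedEmbedding [Fintype V] [Fintype W] (F : SimpleGraph V) (G : SimpleGraph W) :
    (Finset.univ.filter fun f : V → W => Function.Injective f ∧ G.comap f = F).card =
      inducedCount F G * Nat.card (F ≃g F) := by
  rw [Finset.card_eq_sum_card_fiberwise (f := fun f : V → W => Finset.univ.image f)
    (t := ((Finset.univ : Finset W).powersetCard (Fintype.card V)).filter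
      fun S : Finset W => Nonempty (G.induce (S : Set W) ≃g F))]
  · unfold inducedCount
    rw [← smul_eq_mul, ← Finset.sum_const]
    refine Finset.sum_congr rfl fun S hS => ?_
    simp only [Finset.mem_filter, Finset.mem_powersetCard, Finset.subset_univ, true_and] at hS
    obtain ⟨hcard, ⟨e⟩⟩ := hS
    rw [← Nat.card_eq_finsetCard]
    have hmaps : ∀ σ : F ≃g F, (fun v => (e.symm (σ v)).1) ∈
        {f ∈ Finset.univ.filter fun f : V → W => Function.Injective f ∧ G.comap f = F |
          Finset.univ.image f = S} := by
      intro σ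
      simp only [Finset.mem_filter, Finset.mem_univ, true_and]
      have hinj : Function.Injective fun v => (e.symm (σ v)).1 := fun u v huv =>
        σ.injective (e.symm.injective (Subtype.ext huv))
      refine ⟨⟨hinj, ?_⟩, ?_⟩
      · ext u v
        have h1 := e.symm.map_rel_iff' (a := σ u) (b := σ v)
        have h2 := σ.map_rel_iff' (a := u) (b := v)
        exact h1.trans h2
      · refine Finset.eq_of_subset_of_card_le ?_ ?_
        · intro w hw
          obtain ⟨v, -, rfl⟩ := Finset.mem_image.1 hw
          exact (e.symm (σ v)).2
        · rw [hcard, Finset.card_image_of_injective _ hinj, Finset.card_univ]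
    refine (Nat.card_congr (Equiv.ofBijective (fun σ : F ≃g F => ⟨_, hmaps σ⟩) ⟨?_, ?_⟩)).symm
    · intro σ τ h
      ext v
      have h1 := congrFun (Subtype.ext_iff.1 h) v
      exact e.symm.injective (Subtype.ext h1)
    · rintro ⟨f, hf⟩
      simp only [Finset.mem_filter, Finset.mem_univ, true_and] at hf
      obtain ⟨⟨hinj, hcomap⟩, himage⟩ := hf
      have hmem : ∀ v, f v ∈ (S : Set W) := by
        intro v
        rw [← himage]
        simp
      have hinj' : Function.Injective fun v => e ⟨f v, hmem v⟩ := fun u v huv =>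
        hinj (Subtype.ext_iff.1 (e.injective huv))
      refine ⟨⟨Equiv.ofBijective _ (Finite.injective_iff_bijective.1 hinj'), ?_⟩, ?_⟩
      · intro u v
        have h1 := e.map_rel_iff' (a := ⟨f u, hmem u⟩) (b := ⟨f v, hmem v⟩)
        exact h1.trans (comap_eq_iff.1 hcomap u v)
      · refine Subtype.ext (funext fun v => ?_)
        exact congrArg Subtype.val (e.symm_apply_apply ⟨f v, hmem v⟩)
  · intro f hf
    simp only [Finset.coe_filter, Finset.mem_univ, true_and, Set.mem_ofPred_eq,
      Finset.mem_powersetCard, Finset.subset_univ] at hf ⊢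
    obtain ⟨hinj, hcomap⟩ := hf
    refine ⟨by rw [Finset.card_image_of_injective _ hinj, Finset.card_univ], ⟨?_⟩⟩
    refine RelIso.symm ⟨Equiv.ofBijective
      (fun v => (⟨f v, by simp⟩ : ((Finset.univ.image f : Finset W) : Set W))) ⟨?_, ?_⟩, ?_⟩
    · intro u v huv
      exact hinj (Subtype.ext_iff.1 huv)
    · rintro ⟨w, hw⟩
      simp only [Finset.coe_image, Finset.coe_univ, Set.image_univ] at hw
      obtain ⟨v, rfl⟩ := hw
      exact ⟨v, rfl⟩
    · intro u v
      exact comap_eq_iff.1 hcomap u v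

theorem card_aut_pos [Fintype V] (F : SimpleGraph V) : 0 < Nat.card (F ≃g F) := by
  have : Finite (F ≃g F) := Finite.of_injective _ RelIso.toEquiv_injective
  have : Nonempty (F ≃g F) := ⟨RelIso.refl _⟩
  exact Nat.card_pos

open scoped Classical in
theorem blowupDensity_const [Fintype V] [DecidableEq V] [Fintype W] (F : SimpleGraph V) (G : SimpleGraph W)
    (c : ℝ) : blowupDensity F G (fun _ => c) =
      (Finset.univ.filter fun f : V → W => G.comap f = F).card * c ^ Fintype.card V := by
  simp only [blowupDensity, Finset.prod_const, ← Finset.sum_filter, Finset.sum_const, nsmul_eq_mul,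
    Finset.card_univ]
  congr!

-- Embeddings are counted by all maps that pull `G` back to `F`, injective or not. The error is
-- harmless because `n ^ s / n.choose s` tends to `s!`.
open scoped Classical in
theorem inducedDensity_mul_le [Fintype V] (F : SimpleGraph V) {n : ℕ} (hn : 1 ≤ n)
    (hV : Fintype.card V ≤ n) (G : SimpleGraph (Fin n)) :
    inducedDensity F G ≤ (n : ℝ) ^ Fintype.card V / n.choose (Fintype.card V) *
      (blowupDensity F G (fun _ => (n : ℝ)⁻¹) / Nat.card (F ≃g F)) := by
  have hn' : (0 : ℝ) < n := by exact_mod_cast hn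
  have ha : (0 : ℝ) < Nat.card (F ≃g F) := by exact_mod_cast card_aut_pos F
  have hc : (0 : ℝ) < n.choose (Fintype.card V) := by exact_mod_cast Nat.choose_pos hV
  have h1 : (inducedCount F G * Nat.card (F ≃g F) : ℝ) ≤
      (Finset.univ.filter fun f : V → Fin n => G.comap f = F).card := by
    rw [← Nat.cast_mul, ← card_inducedEmbedding]
    exact_mod_cast Finset.card_le_card fun f hf => by
      simp only [Finset.mem_filter] at hf ⊢
      exact ⟨hf.1, hf.2.2⟩
  rw [blowupDensity_const, inducedDensity, Fintype.card_fin, inv_pow]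
  rw [div_mul_eq_mul_div, div_le_div_iff_of_pos_right hc, ← mul_div_assoc, le_div_iff₀ ha]
  refine h1.trans (le_of_eq ?_)
  field_simp

theorem tendsto_pow_div_choose (s : ℕ) :
    Tendsto (fun n : ℕ => (n : ℝ) ^ s / n.choose s) atTop (𝓝 s.factorial) := by
  have h := ((IsEquivalent.refl (u := fun n : ℕ => (n : ℝ) ^ s)).div
    (isEquivalent_choose s)).symm
  refine h.tendsto_nhds (tendsto_const_nhds.congr' ?_)
  filter_upwards [eventually_ge_atTop 1] with n hn
  have : (0 : ℝ) < n := by exact_mod_cast hn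
  simp only [Pi.div_apply]
  field_simp

/-- Upper bound for the inducibility by optimal blow-up densities. -/
theorem cliqueFreeInducibility_le [Fintype V] {F : SimpleGraph V} {B : ℝ}
    (hB : ∀ (n : ℕ) (G : SimpleGraph (Fin n)), 1 ≤ n →
      blowupDensity F G (fun _ => (n : ℝ)⁻¹) ≤ B) {k : ℕ} (hk : 2 ≤ k) :
    cliqueFreeInducibility F k ≤ (Fintype.card V).factorial * (B / Nat.card (F ≃g F)) := by
  refine le_of_tendsto_of_tendsto (tendsto_maxDensity F hk)
    ((tendsto_pow_div_choose (Fintype.card V)).mul_const _) ?_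
  filter_upwards [eventually_ge_atTop 1, eventually_ge_atTop (Fintype.card V)] with n hn hV
  obtain ⟨G, -, hG⟩ := (isGreatest_maxDensity F hk n).1
  rw [← hG]
  refine (inducedDensity_mul_le F hn hV G).trans ?_
  gcongr
  exact hB n G hn

-- In the blow-up with parts of size `q`, a good map `f` is paired with an injection `g` into `Fin
-- q`: `g` makes the pair injective and `f` makes it induce `F`.
open scoped Classical in
theorem card_mul_descFactorial_le [Fintype V] (F : SimpleGraph V) (N q : ℕ) :
    (Finset.univ.filter fun f : V → Fin N => (⊤ : SimpleGraph (Fin N)).comap f = F).card *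
      q.descFactorial (Fintype.card V) ≤
      inducedCount F ((⊤ : SimpleGraph (Fin N)).comap
        fun v : Fin (N * q) => (finProdFinEquiv.symm v).1) * Nat.card (F ≃g F) := by
  have h : q.descFactorial (Fintype.card V) = (Finset.univ : Finset (V ↪ Fin q)).card := by
    rw [Finset.card_univ, Fintype.card_embedding_eq, Fintype.card_fin]
  rw [← card_inducedEmbedding, h, ← Finset.card_product]
  refine Finset.card_le_card_of_injOn
    (fun p : (V → Fin N) × (V ↪ Fin q) => fun v => finProdFinEquiv (p.1 v, p.2 v)) ?_ ?_
  · rintro ⟨f, g⟩ hfg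
    simp only [Finset.coe_product, Set.mem_prod, Finset.coe_filter, Finset.mem_univ, true_and,
      Set.mem_ofPred_eq] at hfg ⊢
    refine ⟨fun u v huv => ?_, ?_⟩
    · have := finProdFinEquiv.injective huv
      exact g.injective (Prod.ext_iff.1 this).2
    · rw [← hfg.1, comap_eq_iff]
      intro u v
      rw [comap_adj, comap_adj, Equiv.symm_apply_apply, Equiv.symm_apply_apply]
  · rintro ⟨f, g⟩ - ⟨f', g'⟩ - h
    have h' : ∀ v, (f v, g v) = (f' v, g' v) := fun v => finProdFinEquiv.injective (congrFun h v)
    refine Prod.ext (funext fun v => (Prod.ext_iff.1 (h' v)).1) ?_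
    ext v
    exact congrArg Fin.val (Prod.ext_iff.1 (h' v)).2

/-- Lower bound for the inducibility by balanced blow-ups of the complete graph on `N` vertices. -/
theorem le_cliqueFreeInducibility [Fintype V] (F : SimpleGraph V) {N k : ℕ} (hN : 1 ≤ N)
    (hk : N < k) :
    (Fintype.card V).factorial * (blowupDensity F (⊤ : SimpleGraph (Fin N)) (fun _ => (N : ℝ)⁻¹) /
      Nat.card (F ≃g F)) ≤ cliqueFreeInducibility F k := by
  classical
  have hN' : (0 : ℝ) < N := by exact_mod_cast hN
  have ha : (0 : ℝ) < Nat.card (F ≃g F) := by exact_mod_cast card_aut_pos F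
  have hk2 : 2 ≤ k := by omega
  set s := Fintype.card V with hs
  set M := (Finset.univ.filter fun f : V → Fin N =>
    (⊤ : SimpleGraph (Fin N)).comap f = F).card with hM
  -- The limit exists, so it may be computed along the orders `N * q`, where all parts have equal
  -- size.
  have hsub : Tendsto (fun q : ℕ => N * q) atTop atTop :=
    tendsto_id.const_mul_atTop' (by omega)
  have hlim : Tendsto (fun q : ℕ => (q.descFactorial s : ℝ) / ((N * q).choose s : ℝ)) atTop
      (𝓝 (s.factorial / (N : ℝ) ^ s)) := by
    have h := ((isEquivalent_descFactorial s).div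
      ((isEquivalent_choose s).comp_tendsto hsub)).symm
    refine h.tendsto_nhds (tendsto_const_nhds.congr' ?_)
    filter_upwards [eventually_ge_atTop 1] with q hq
    have : (0 : ℝ) < q := by exact_mod_cast hq
    simp only [Pi.div_apply, Function.comp, Nat.cast_mul, mul_pow]
    field_simp
  have hlim' := hlim.const_mul (M / Nat.card (F ≃g F) : ℝ)
  have hle := le_of_tendsto_of_tendsto hlim' ((tendsto_maxDensity F hk2).comp hsub) ?_
  · refine le_of_eq_of_le ?_ hle
    rw [blowupDensity_const, ← hs, ← hM, inv_pow]
    field_simp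
  · filter_upwards with q
    refine le_trans ?_ ((isGreatest_maxDensity F hk2 (N * q)).2 ⟨(⊤ : SimpleGraph (Fin N)).comap
      fun v : Fin (N * q) => (finProdFinEquiv.symm v).1, ?_, rfl⟩)
    · have h1 : (M * q.descFactorial s : ℝ) ≤ inducedCount F ((⊤ : SimpleGraph (Fin N)).comap
          fun v : Fin (N * q) => (finProdFinEquiv.symm v).1) * (Nat.card (F ≃g F) : ℝ) := by
        exact_mod_cast card_mul_descFactorial_le F N q
      rw [inducedDensity, Fintype.card_fin, ← mul_div_assoc]
      refine div_le_div_of_nonneg_right ?_ (Nat.cast_nonneg _)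
      rw [div_mul_eq_mul_div, div_le_iff₀ ha]
      exact h1
    · refine Colorable.cliqueFree (n := N) ?_ hk
      exact ⟨Coloring.mk (fun v => (finProdFinEquiv.symm v).1) fun {u v} huv => huv⟩

/-! ### Turán graphs that are not complete -/

theorem turanGraph_isCompleteMultipartite (s r : ℕ) : (turanGraph s r).IsCompleteMultipartite := by
  refine ⟨fun u v w h1 h2 => ?_⟩
  simp only [turanGraph_adj, ne_eq, not_not] at h1 h2 ⊢
  exact h1.trans h2

/-- Parts are residue classes modulo `r`, of size `s / r` or `s / r + 1`. -/
theorem turanGraph_isBalanced (s : ℕ) {r : ℕ} (hr : 0 < r) : (turanGraph s r).IsBalanced := by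
  have h : ∀ u : Fin s, {w | ¬ (turanGraph s r).Adj u w}.ncard =
      s / r + if (u : ℕ) % r < s % r then 1 else 0 := by
    intro u
    rw [← Nat.count_modEq_card s hr u, Nat.count_eq_card_filter_range, ← Set.ncard_coe_finset,
      ← Set.ncard_image_of_injective _ Fin.val_injective]
    congr 1
    ext w
    rw [Finset.mem_coe, Finset.mem_filter, Finset.mem_range]
    simp only [turanGraph_adj, ne_eq, not_not, Set.mem_image, Set.mem_ofPred_eq, Nat.ModEq]
    constructor
    · rintro ⟨v, hv, rfl⟩
      exact ⟨v.2, hv.symm⟩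
    · rintro ⟨hw, hw'⟩
      exact ⟨⟨w, hw⟩, hw'.symm, rfl⟩
  intro u v
  rw [h, h]
  split_ifs <;> omega

/-- A good map is constant on parts, hence determined by its values on the first `r` vertices, one
from each part. So at most `N ^ r` of the `N ^ s` maps are good. -/
theorem blowupDensity_turanGraph_top_le {s r N : ℕ} (hr : 0 < r) (hrs : r < s) (hN : 1 ≤ N) :
    blowupDensity (turanGraph s r) (⊤ : SimpleGraph (Fin N)) (fun _ => (N : ℝ)⁻¹) ≤ (N : ℝ)⁻¹ := by
  classical
  have hN' : (1 : ℝ) ≤ N := by exact_mod_cast hN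
  have hcard : (Finset.univ.filter fun f : Fin s → Fin N =>
      (⊤ : SimpleGraph (Fin N)).comap f = turanGraph s r).card ≤ N ^ r := by
    have h : N ^ r = (Finset.univ : Finset (Fin r → Fin N)).card := by simp
    rw [h]
    refine Finset.card_le_card_of_injOn (fun f => f ∘ Fin.castLE hrs.le) (by simp) ?_
    intro f hf g hg hfg
    simp only [Finset.coe_filter, Finset.mem_univ, true_and, Set.mem_ofPred_eq, comap_eq_iff,
      top_adj, turanGraph_adj, not_iff_not, ne_eq] at hf hg
    ext v : 1
    have hlt := Nat.mod_lt (v : ℕ) hr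
    rw [(hf v (Fin.castLE hrs.le ⟨v % r, hlt⟩)).2 (by simp),
      (hg v (Fin.castLE hrs.le ⟨v % r, hlt⟩)).2 (by simp)]
    exact congrFun hfg ⟨v % r, hlt⟩
  rw [blowupDensity_const, Fintype.card_fin, inv_pow, ← div_eq_mul_inv,
    div_le_iff₀ (by positivity)]
  calc _ ≤ (N : ℝ) ^ r := by exact_mod_cast hcard
    _ ≤ (N : ℝ) ^ (s - 1) := pow_le_pow_right₀ hN' (by omega)
    _ = _ := by
      obtain ⟨t, rfl⟩ : ∃ t, s = t + 1 := ⟨s - 1, by omega⟩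
      rw [pow_succ]
      field_simp
      simp

/-- Beyond some index all terms lie below any given positive term, so only finitely many compete for
the maximum. -/
theorem exists_forall_le_of_tendsto_zero {f : ℕ → ℝ} (h0 : ∀ n, 0 ≤ f n)
    (hf : Tendsto f atTop (𝓝 0)) : ∃ N, 1 ≤ N ∧ ∀ n, 1 ≤ n → f n ≤ f N := by
  by_cases hpos : ∃ m, 1 ≤ m ∧ 0 < f m
  · obtain ⟨m, hm, hfm⟩ := hpos
    obtain ⟨T, hT⟩ := eventually_atTop.1 (hf.eventually (gt_mem_nhds hfm))
    obtain ⟨N, hN, hmax⟩ := (Finset.Icc 1 (max m T)).exists_max_image f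
      ⟨m, Finset.mem_Icc.2 ⟨hm, le_max_left _ _⟩⟩
    refine ⟨N, (Finset.mem_Icc.1 hN).1, fun n hn => ?_⟩
    rcases le_total n (max m T) with h | h
    · exact hmax n (Finset.mem_Icc.2 ⟨hn, h⟩)
    · exact (hT n ((le_max_right _ _).trans h)).le.trans
        (hmax m (Finset.mem_Icc.2 ⟨hm, le_max_left _ _⟩))
  · push Not at hpos
    exact ⟨1, le_rfl, fun n hn => (hpos n hn).trans (h0 1)⟩

theorem not_inducibilityDiverse_turanGraph {s r : ℕ} (hr : 0 < r) (hrs : r < s) :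
    ¬ InducibilityDiverse (turanGraph s r) := by
  classical
  set F := turanGraph s r
  obtain ⟨N, hN, hmax⟩ := exists_forall_le_of_tendsto_zero
    (f := fun N => blowupDensity F (⊤ : SimpleGraph (Fin N)) fun _ => (N : ℝ)⁻¹)
    (fun N => by rw [blowupDensity_const]; positivity)
    (squeeze_zero' (Eventually.of_forall fun N => by rw [blowupDensity_const]; positivity)
      (eventually_atTop.2 ⟨1, fun N hN => blowupDensity_turanGraph_top_le hr hrs hN⟩)
      tendsto_inv_atTop_nhds_zero_nat)
  intro h
  -- Blow-ups of the optimal `K_N` are `K_{N+1}`-free, so the universal upper bound is already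
  -- attained here.
  obtain ⟨m, hm, hlt⟩ := h (N + 1) (by omega)
  refine absurd hlt (not_lt.2 ?_)
  refine le_trans (cliqueFreeInducibility_le (fun n G hn => ?_) (by omega))
    (le_cliqueFreeInducibility F hN (Nat.lt_succ_self N))
  have hn' : (n : ℝ) ≠ 0 := by exact_mod_cast (by omega : n ≠ 0)
  obtain ⟨N', hN', hle⟩ := exists_blowupDensity_le_top (turanGraph_isCompleteMultipartite s r)
    (turanGraph_isBalanced s hr) n G (x := fun _ => (n : ℝ)⁻¹)
    ⟨fun _ => by positivity, by simp [hn']⟩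
  exact hle.trans (hmax N' hN')

/-! ### Complete graphs -/

theorem cliqueFreeInducibility_le_maxDensity {V : Type*} [Fintype V] (F : SimpleGraph V) {k n : ℕ}
    (hk : 2 ≤ k) (hn : Fintype.card V ≤ n) : cliqueFreeInducibility F k ≤ maxDensity F k n := by
  refine le_of_tendsto (tendsto_maxDensity F hk) (eventually_atTop.2 ⟨n, fun m hm => ?_⟩)
  induction m, hm using Nat.le_induction with
  | base => exact le_rfl
  | succ m hm ih => exact (maxDensity_succ_le F hk (hn.trans hm)).trans ih

theorem inducedDensity_top_lt_one {s n : ℕ} (hs : 2 ≤ s) (hsn : s ≤ n) {G : SimpleGraph (Fin n)}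
    (hG : G ≠ ⊤) : inducedDensity (⊤ : SimpleGraph (Fin s)) G < 1 := by
  classical
  have : ∃ i j, i ≠ j ∧ ¬ G.Adj i j := by
    by_contra! h
    apply hG
    ext i j
    simp only [top_adj]
    exact ⟨fun h' => h'.ne, h i j⟩
  obtain ⟨i, j, hne, hij⟩ := this
  obtain ⟨S, hS, -, hcard⟩ := Finset.exists_subsuperset_card_eq (n := s)
    (Finset.subset_univ {i, j}) (by rwa [Finset.card_pair hne]) (by simpa using hsn)
  have hc : (0 : ℝ) < n.choose s := by exact_mod_cast Nat.choose_pos hsn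
  rw [inducedDensity, Fintype.card_fin, Fintype.card_fin, div_lt_one hc, Nat.cast_lt]
  have h : n.choose s = ((Finset.univ : Finset (Fin n)).powersetCard s).card := by simp
  rw [h, inducedCount]
  refine Finset.card_lt_card ?_
  rw [Fintype.card_fin, Finset.filter_ssubset]
  refine ⟨S, Finset.mem_powersetCard.2 ⟨Finset.subset_univ _, hcard⟩, ?_⟩
  rintro ⟨e⟩
  have hi : i ∈ (S : Set (Fin n)) := hS (by simp)
  have hj : j ∈ (S : Set (Fin n)) := hS (by simp)
  have h1 := e.map_rel_iff' (a := ⟨i, hi⟩) (b := ⟨j, hj⟩)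
  refine hij (h1.1 ?_)
  rw [top_adj]
  exact fun h2 => hne (Subtype.ext_iff.1 (e.injective h2))

theorem cliqueFreeInducibility_top_lt_one {s k : ℕ} (hs : 2 ≤ s) (hk : 2 ≤ k) :
    cliqueFreeInducibility (⊤ : SimpleGraph (Fin s)) k < 1 := by
  -- A single order bounds the limit, so strictness survives: `n ≥ s` gives monotonicity from there
  -- on, and `n ≥ k` keeps `K_n` from being `K_k`-free.
  refine lt_of_le_of_lt (cliqueFreeInducibility_le_maxDensity _ hk (n := max s k) (by simp)) ?_
  obtain ⟨G, hG, hGx⟩ := (isGreatest_maxDensity (⊤ : SimpleGraph (Fin s)) hk (max s k)).1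
  rw [← hGx]
  refine inducedDensity_top_lt_one hs (le_max_left _ _) ?_
  rintro rfl
  exact (Embedding.completeGraph (Fin.castLEEmb (le_max_right s k))).isContained.not_cliqueFree hG

theorem descFactorial_div_pow_le_cliqueFreeInducibility_top {s N : ℕ} (hN : 1 ≤ N) :
    (N.descFactorial s : ℝ) / (N : ℝ) ^ s ≤
      cliqueFreeInducibility (⊤ : SimpleGraph (Fin s)) (N + 1) := by
  classical
  refine le_trans ?_ (le_cliqueFreeInducibility _ hN (Nat.lt_succ_self N))
  have ha : (0 : ℝ) < Nat.card ((⊤ : SimpleGraph (Fin s)) ≃g (⊤ : SimpleGraph (Fin s))) := by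
    exact_mod_cast card_aut_pos _
  -- An upper bound for `|Aut K_s|` is enough to cancel the factorial.
  have ha' : (Nat.card ((⊤ : SimpleGraph (Fin s)) ≃g (⊤ : SimpleGraph (Fin s))) : ℝ) ≤
      s.factorial := by
    have h := Nat.card_le_card_of_injective (RelIso.toEquiv :
      ((⊤ : SimpleGraph (Fin s)) ≃g (⊤ : SimpleGraph (Fin s))) → _) RelIso.toEquiv_injective
    rw [Nat.card_perm, Nat.card_fin] at h
    exact_mod_cast h
  have hM : N.descFactorial s ≤ (Finset.univ.filter fun f : Fin s → Fin N =>
      (⊤ : SimpleGraph (Fin N)).comap f = ⊤).card := by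
    have h : N.descFactorial s = (Finset.univ : Finset (Fin s ↪ Fin N)).card := by
      rw [Finset.card_univ, Fintype.card_embedding_eq, Fintype.card_fin, Fintype.card_fin]
    rw [h]
    refine Finset.card_le_card_of_injOn (fun f => f) ?_ (DFunLike.coe_injective.injOn)
    intro f _
    simp only [Finset.coe_filter, Finset.mem_univ, true_and, Set.mem_ofPred_eq]
    ext u v
    simp
  rw [blowupDensity_const, Fintype.card_fin, inv_pow, ← div_eq_mul_inv, ← mul_div_assoc,
    le_div_iff₀ ha, mul_comm]
  gcongr

theorem inducibilityDiverse_top {s : ℕ} (hs : 2 ≤ s) :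
    InducibilityDiverse (⊤ : SimpleGraph (Fin s)) := by
  intro k hk
  have hlim : Tendsto (fun N : ℕ => (N.descFactorial s : ℝ) / (N : ℝ) ^ s) atTop (𝓝 1) := by
    refine (isEquivalent_iff_tendsto_one ?_).1 (isEquivalent_descFactorial s)
    filter_upwards [eventually_ge_atTop 1] with N hN
    have : (0 : ℝ) < N := by exact_mod_cast hN
    positivity
  obtain ⟨N, hlt, hN⟩ := ((hlim.eventually (lt_mem_nhds
    (cliqueFreeInducibility_top_lt_one hs hk))).and (eventually_ge_atTop k)).exists
  exact ⟨N + 1, by omega,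
    hlt.trans_le (descFactorial_div_pow_le_cliqueFreeInducibility_top (by omega))⟩

end SimpleGraph

/-- `SimpleGraph.turanGraph s r` is the Turán graph `T(s, r)`: the complete `r`-partite graph on
`s` vertices whose part sizes differ by at most one (the `r` parts are non-empty as `r ≤ s`). -/
theorem corollary1p9 (s r : ℕ) (hr : 2 ≤ r) (hrs : r ≤ s) :
    Inducibility.InducibilityDiverse (SimpleGraph.turanGraph s r) ↔
      SimpleGraph.turanGraph s r = ⊤ := by
  constructor
  · intro h
    by_contra hne
    rw [SimpleGraph.turanGraph_eq_top] at hne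
    push Not at hne
    exact SimpleGraph.not_inducibilityDiverse_turanGraph (by omega) hne.2 h
  · intro h
    rw [h]
    exact SimpleGraph.inducibilityDiverse_top (hr.trans hrs)
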